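/- Let $G$ be a finite simple connected graph with a cut-vertex $u$ (a vertex such that $G-u$ is disconnected). Eigenvalues of a graph are those of its $(0,1)$-adjacency matrix, listed with multiplicity as $\lambda_1\ge\lambda_2\ge\cdots$; the largest one, $\lambda_1$, is called the index of the graph. Let $\alpha_1\ge\alpha_2$ be the two largest among the indices of the connected components of $G-u$, where each component contributes its own index (so $\alpha_1=\alpha_2$ if two components share the largest index). Then: 1) if $\alpha_1=\alpha_2$, then $\lambda_2(G)=\alpha_1$; 2) if $\alpha_1>\alpha_2$, then $\alpha_2<\lambda_2(G)<\alpha_1$. -/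

import Mathlib

open Classical in
/-- The eigenvalues of a finite graph: the real roots of the characteristic polynomial of its
`(0,1)`-adjacency matrix, with multiplicity, listed in non-increasing order. -/
noncomputable def graphSpectrum {V : Type*} [Finite V] (G : SimpleGraph V) : List ℝ :=
  letI := Fintype.ofFinite V
  (G.adjMatrix ℝ).charpoly.roots.sort (· ≥ ·)

/-- The index `λ₁(G)` of a graph: its largest eigenvalue. -/
noncomputable def graphIndex {V : Type*} [Finite V] (G : SimpleGraph V) : ℝ :=
  (graphSpectrum G).getD 0 0

/-- The second largest eigenvalue `λ₂(G)` of a graph, counted with multiplicity. The default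
value `0` occurs only for graphs with fewer than two vertices. -/
noncomputable def secondEigenvalue {V : Type*} [Finite V] (G : SimpleGraph V) : ℝ :=
  (graphSpectrum G).getD 1 0

/-- The graph `G - u`. -/
abbrev deleteVertex {V : Type*} (G : SimpleGraph V) (u : V) :
    SimpleGraph ({u}ᶜ : Set V) :=
  G.induce ({u}ᶜ : Set V)

/-- `u` is a cut-vertex of `G`: deleting `u` separates two vertices that are joined in `G`. -/
def IsCutVertex {V : Type*} (G : SimpleGraph V) (u : V) : Prop :=
  ∃ v w : ({u}ᶜ : Set V), G.Reachable v w ∧ ¬ (deleteVertex G u).Reachable v w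

/-- `α₁ ≥ α₂` are the two largest indices of connected components of `H`, where components with
equal index are counted separately. -/
def AreTwoLargestComponentIndices {V : Type*} [Finite V] (H : SimpleGraph V) (α₁ α₂ : ℝ) : Prop :=
  ∃ C₁ C₂ : H.ConnectedComponent, C₁ ≠ C₂ ∧
    graphIndex C₁.toSimpleGraph = α₁ ∧ graphIndex C₂.toSimpleGraph = α₂ ∧ α₂ ≤ α₁ ∧
    ∀ C : H.ConnectedComponent, C ≠ C₁ → graphIndex C.toSimpleGraph ≤ α₂

/-! Both bounds are interlacing arguments with Rayleigh quotients of the adjacency matrix. The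
Perron vectors of two components of `G - u`, extended by zero, span a plane. This plane meets the
orthogonal complement of a top eigenvector, where `λ₂` bounds the quotient, so `α₂ ≤ λ₂`. Dually,
the plane of two leading eigenvectors contains a nonzero vector vanishing at `u`. Its quotient is at
least `λ₂`, and at most `α₁` because it lives on `G - u`.

Strictness comes from the eigenvector equation at `u`. Equality in either bound with `α₂ < α₁`
produces an eigenvector of `G` that is zero at `u` and is, up to scaling, the Perron vector of one
component. Its neighbour sum at `u` should be zero, yet connectedness gives `u` a neighbour in that
component (`exists_adj_component`). The equality cases rest on `dotProduct_mulVec_eq_of_rayleigh_eq`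
below and on `sum_sub_dotProduct_mulVec_eq` above. -/

/-! ### Rayleigh quotients and the two largest eigenvalues -/

open Matrix in
theorem Matrix.dotProduct_mulVec_of_isSymm {n : Type*} [Fintype n] {A : Matrix n n ℝ}
    (hA : A.IsSymm) (v w : n → ℝ) : v ⬝ᵥ A *ᵥ w = w ⬝ᵥ A *ᵥ v := by
  rw [dotProduct_mulVec, dotProduct_comm, ← mulVec_transpose, hA.eq]

open Matrix in
/-- A vector of a subspace attaining the bound of the Rayleigh quotient on this subspace is
stationary for it. -/
theorem Matrix.dotProduct_mulVec_eq_of_rayleigh_eq {n : Type*} [Fintype n] {A : Matrix n n ℝ}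
    (hA : A.IsSymm) (S : Submodule ℝ (n → ℝ)) {μ : ℝ}
    (hS : ∀ v ∈ S, v ⬝ᵥ A *ᵥ v ≤ μ * (v ⬝ᵥ v)) {z : n → ℝ} (hz : z ∈ S)
    (hzμ : z ⬝ᵥ A *ᵥ z = μ * (z ⬝ᵥ z)) {v : n → ℝ} (hv : v ∈ S) :
    v ⬝ᵥ A *ᵥ z = μ * (v ⬝ᵥ z) := by
  have key : ∀ t : ℝ, 0 ≤ 2 * t * (μ * (v ⬝ᵥ z) - v ⬝ᵥ A *ᵥ z)
      + t ^ 2 * (μ * (v ⬝ᵥ v) - v ⬝ᵥ A *ᵥ v) := by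
    intro t
    have h := hS _ (S.add_mem hz (S.smul_mem t hv))
    simp only [mulVec_add, mulVec_smul, add_dotProduct, dotProduct_add, smul_dotProduct,
      dotProduct_smul, smul_eq_mul] at h
    rw [dotProduct_mulVec_of_isSymm hA z v, dotProduct_comm z v] at h
    nlinarith
  set b := μ * (v ⬝ᵥ z) - v ⬝ᵥ A *ᵥ z with hb
  set c := μ * (v ⬝ᵥ v) - v ⬝ᵥ A *ᵥ v with hc
  have hc0 : 0 ≤ c := sub_nonneg.2 (hS v hv)
  -- The minimiser would be `-b / c`; the shift by one keeps the denominator positive when `c = 0`,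
  -- and the value is still negative unless `b = 0`.
  have h := key (-b / (c + 1))
  have h2 : 2 * (-b / (c + 1)) * b + (-b / (c + 1)) ^ 2 * c
      = -(b ^ 2 * (c + 2)) / (c + 1) ^ 2 := by
    field_simp
    ring
  rw [h2, neg_div, Left.nonneg_neg_iff, div_nonpos_iff] at h
  have hb0 : b = 0 := by
    by_contra hne
    have : 0 < b ^ 2 * (c + 2) := by positivity
    have : 0 < (c + 1) ^ 2 := by positivity
    rcases h with h | h <;> linarith
  linarith

open Matrix in
theorem Matrix.IsHermitian.eigenvectorBasis_dotProduct_mulVec {n : Type*} [Fintype n]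
    [DecidableEq n] {A : Matrix n n ℝ} (hA : A.IsHermitian) (z : n → ℝ) :
    z ⬝ᵥ A *ᵥ z = ∑ i, hA.eigenvalues i * (z ⬝ᵥ ⇑(hA.eigenvectorBasis i)) ^ 2 := by
  have h := hA.eigenvectorBasis.sum_inner_mul_inner (WithLp.toLp 2 z) (WithLp.toLp 2 (A *ᵥ z))
  simp only [EuclideanSpace.inner_eq_star_dotProduct, star_trivial] at h
  rw [dotProduct_comm, ← h]
  refine Finset.sum_congr rfl fun i _ ↦ ?_
  rw [dotProduct_comm (A *ᵥ z), dotProduct_mulVec_of_isSymm (by simpa using! hA),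
    hA.mulVec_eigenvectorBasis, dotProduct_smul, dotProduct_comm z, smul_eq_mul]
  ring

open Matrix in
theorem Matrix.IsHermitian.eigenvectorBasis_dotProduct_self {n : Type*} [Fintype n]
    [DecidableEq n] {A : Matrix n n ℝ} (hA : A.IsHermitian) (z : n → ℝ) :
    z ⬝ᵥ z = ∑ i, (z ⬝ᵥ ⇑(hA.eigenvectorBasis i)) ^ 2 := by
  have h := hA.eigenvectorBasis.sum_inner_mul_inner (WithLp.toLp 2 z) (WithLp.toLp 2 z)
  simp only [EuclideanSpace.inner_eq_star_dotProduct, star_trivial] at h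
  rw [← h]
  refine Finset.sum_congr rfl fun i _ ↦ ?_
  rw [dotProduct_comm z, sq]

open Matrix in
theorem Matrix.IsHermitian.eigenvectorBasis_dotProduct {n : Type*} [Fintype n]
    [DecidableEq n] {A : Matrix n n ℝ} (hA : A.IsHermitian) (i j : n) :
    ⇑(hA.eigenvectorBasis i) ⬝ᵥ ⇑(hA.eigenvectorBasis j) = if i = j then 1 else 0 := by
  have h := orthonormal_iff_ite.1 hA.eigenvectorBasis.orthonormal i j
  rwa [EuclideanSpace.inner_eq_star_dotProduct, star_trivial, dotProduct_comm] at h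

open Matrix in
theorem Matrix.IsHermitian.sort_roots_charpoly_real {n : Type*} [Fintype n]
    [DecidableEq n] {A : Matrix n n ℝ} (hA : A.IsHermitian) :
    A.charpoly.roots.sort (· ≥ ·) = List.ofFn hA.eigenvalues₀ := by
  simpa using! hA.sort_roots_charpoly_eq_eigenvalues₀

open Matrix in
theorem graphIndex_spec {V : Type*} [Fintype V] [Nonempty V] (G : SimpleGraph V)
    [DecidableRel G.Adj] :
    (∃ x : V → ℝ, x ≠ 0 ∧ G.adjMatrix ℝ *ᵥ x = graphIndex G • x) ∧
      ∀ z : V → ℝ, z ⬝ᵥ G.adjMatrix ℝ *ᵥ z ≤ graphIndex G * (z ⬝ᵥ z) := by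
  classical
  have hA : (G.adjMatrix ℝ).IsHermitian := by
    simp
  let e : Fin (Fintype.card V) ≃ V := Fintype.equivOfCardEq (Fintype.card_fin _)
  let o : Fin (Fintype.card V) := ⟨0, Fintype.card_pos⟩
  have hidx : graphIndex G = hA.eigenvalues (e o) := by
    have h1 : graphSpectrum G = List.ofFn hA.eigenvalues₀ := by
      rw [← hA.sort_roots_charpoly_real, graphSpectrum]
      congr!
    have h2 : hA.eigenvalues (e o) = hA.eigenvalues₀ o := by
      simp [IsHermitian.eigenvalues, e]
    rw [h2, graphIndex, h1]
    simp [List.getD, o, Fintype.card_pos]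
  have hmax (i : V) : hA.eigenvalues i ≤ hA.eigenvalues (e o) := by
    refine hA.eigenvalues₀_antitone ?_
    simp [e, o]
  rw [hidx]
  refine ⟨⟨_, ?_, hA.mulVec_eigenvectorBasis _⟩, fun z ↦ ?_⟩
  · intro h
    have := hA.eigenvectorBasis_dotProduct (e o) (e o)
    simp [h] at this
  · rw [hA.eigenvectorBasis_dotProduct_mulVec, hA.eigenvectorBasis_dotProduct_self,
      Finset.mul_sum]
    gcongr
    exact hmax _

open Matrix in
theorem secondEigenvalue_spec {V : Type*} [Fintype V] [Nontrivial V] (G : SimpleGraph V)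
    [DecidableRel G.Adj] :
    ∃ (μ : ℝ) (x y : V → ℝ), secondEigenvalue G ≤ μ ∧ x ⬝ᵥ x = 1 ∧ y ⬝ᵥ y = 1 ∧ x ⬝ᵥ y = 0 ∧
      G.adjMatrix ℝ *ᵥ x = μ • x ∧ G.adjMatrix ℝ *ᵥ y = secondEigenvalue G • y ∧
      ∀ z : V → ℝ, z ⬝ᵥ x = 0 →
        z ⬝ᵥ G.adjMatrix ℝ *ᵥ z ≤ secondEigenvalue G * (z ⬝ᵥ z) := by
  classical
  have hA : (G.adjMatrix ℝ).IsHermitian := by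
    simp
  let e : Fin (Fintype.card V) ≃ V := Fintype.equivOfCardEq (Fintype.card_fin _)
  have hc : 1 < Fintype.card V := Fintype.one_lt_card
  let o : Fin (Fintype.card V) := ⟨0, Fintype.card_pos⟩
  -- With two vertices, position 1 is a genuine entry of the spectrum, so the default of `getD`
  -- plays no role.
  let l : Fin (Fintype.card V) := ⟨1, hc⟩
  have hne : e o ≠ e l := by simp [o, l]
  have hidx : secondEigenvalue G = hA.eigenvalues (e l) := by
    have h1 : graphSpectrum G = List.ofFn hA.eigenvalues₀ := by
      rw [← hA.sort_roots_charpoly_real, graphSpectrum]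
      congr!
    have h2 : hA.eigenvalues (e l) = hA.eigenvalues₀ l := by
      simp [IsHermitian.eigenvalues, e]
    rw [h2, secondEigenvalue, h1]
    simp [List.getD, l, hc]
  have hmax (i : V) (hi : i ≠ e o) : hA.eigenvalues i ≤ hA.eigenvalues (e l) := by
    refine hA.eigenvalues₀_antitone ?_
    have : e.symm i ≠ o := fun h ↦ hi (by simp [← h])
    have : (e.symm i : ℕ) ≠ 0 := fun h ↦ this (Fin.ext h)
    have h2 : l ≤ e.symm i := by
      simp only [l, Fin.le_def]
      omega
    simpa [e] using! h2
  rw [hidx]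
  refine ⟨hA.eigenvalues (e o), _, _, hA.eigenvalues₀_antitone ?_, ?_, ?_, ?_,
    hA.mulVec_eigenvectorBasis _, hA.mulVec_eigenvectorBasis _, fun z hz ↦ ?_⟩
  · simp [e, o]
  · simp [hA.eigenvectorBasis_dotProduct]
  · simp [hA.eigenvectorBasis_dotProduct]
  · simp [hA.eigenvectorBasis_dotProduct, hne]
  · rw [hA.eigenvectorBasis_dotProduct_mulVec, hA.eigenvectorBasis_dotProduct_self,
      Finset.mul_sum]
    refine Finset.sum_le_sum fun i _ ↦ ?_
    by_cases hi : i = e o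
    · subst hi
      simp [hz]
    · gcongr
      exact hmax i hi

/-! ### Perron vectors and the defect identity -/

open Matrix in
/-- The Perron vector of a connected graph. -/
theorem SimpleGraph.Connected.exists_pos_eigenvector {V : Type*} [Fintype V]
    {G : SimpleGraph V} [DecidableRel G.Adj] (hG : G.Connected) :
    ∃ p : V → ℝ, (∀ v, 0 < p v) ∧ G.adjMatrix ℝ *ᵥ p = graphIndex G • p := by
  classical
  have := hG.nonempty
  obtain ⟨⟨x, hx0, hx⟩, hmax⟩ := graphIndex_spec G
  have hA := G.isSymm_adjMatrix (α := ℝ)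
  have hself : |x| ⬝ᵥ |x| = x ⬝ᵥ x := by simp [dotProduct]
  -- The matrix entries are nonnegative, so passing to absolute values cannot lower the quotient;
  -- `|x|` is therefore again a maximiser.
  have hle : x ⬝ᵥ G.adjMatrix ℝ *ᵥ x ≤ |x| ⬝ᵥ G.adjMatrix ℝ *ᵥ |x| := by
    simp only [dotProduct, mulVec, Finset.mul_sum]
    refine Finset.sum_le_sum fun i _ ↦ Finset.sum_le_sum fun j _ ↦ (le_abs_self _).trans ?_
    rw [abs_mul, abs_mul, abs_of_nonneg (a := G.adjMatrix ℝ i j)]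
    · rfl
    · rw [SimpleGraph.adjMatrix_apply]; split_ifs <;> norm_num
  have heq : |x| ⬝ᵥ G.adjMatrix ℝ *ᵥ |x| = graphIndex G * (|x| ⬝ᵥ |x|) := by
    have h := hmax |x|
    have h1 : x ⬝ᵥ G.adjMatrix ℝ *ᵥ x = graphIndex G * (x ⬝ᵥ x) := by
      rw [hx, dotProduct_smul, smul_eq_mul]
    rw [hself] at h ⊢
    exact le_antisymm h (h1 ▸ hle)
  have heig : G.adjMatrix ℝ *ᵥ |x| = graphIndex G • |x| := by
    ext v
    have := dotProduct_mulVec_eq_of_rayleigh_eq hA ⊤ (fun v _ ↦ hmax v) (z := |x|) trivial heq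
      (v := Pi.single v 1) trivial
    simpa [single_one_dotProduct] using this
  refine ⟨|x|, fun v ↦ (abs_nonneg (x v)).lt_of_ne' fun hv ↦ hx0 ?_, heig⟩
  ext w
  -- At a zero of `|x|` the eigenvector equation makes a sum of nonnegative neighbour values vanish,
  -- so zeros spread along edges.
  have hstep (a b : V) (hab : G.Adj a b) (ha : x a = 0) : x b = 0 := by
    have h := congrFun heig a
    simp only [SimpleGraph.adjMatrix_mulVec_apply, Pi.smul_apply, Pi.abs_apply, ha, abs_zero,
      smul_zero] at h
    rw [Finset.sum_eq_zero_iff_of_nonneg (fun _ _ ↦ abs_nonneg _)] at h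
    exact abs_eq_zero.1 (h b (by simpa using hab))
  obtain ⟨q⟩ := hG.preconnected v w
  have hv0 : x v = 0 := abs_eq_zero.1 hv
  induction q with
  | nil => exact hv0
  | cons h q ih => exact ih (by simp [hstep _ _ h hv0]) (hstep _ _ h hv0)

-- Ground-state substitution: writing `z = r * p` turns the defect of the quadratic form into a
-- weighted sum of squared differences of `r` along edges. The hypothesis carries an extra factor `p
-- v`, so it is void where `p` vanishes; this admits the vertex `u`.
open Matrix in
theorem Matrix.sum_sub_dotProduct_mulVec_eq {n : Type*} [Fintype n] {A : Matrix n n ℝ}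
    (hA : A.IsSymm) (p r β : n → ℝ) (hp : ∀ v, p v * (A *ᵥ p) v = β v * p v ^ 2) :
    (∑ v, β v * (r v * p v) ^ 2) - (r * p) ⬝ᵥ A *ᵥ (r * p)
      = (∑ v, ∑ w, A v w * (p v * p w) * (r v - r w) ^ 2) / 2 := by
  have h1 : ∑ v, β v * (r v * p v) ^ 2 = ∑ v, ∑ w, A v w * (p v * p w) * r v ^ 2 := by
    refine Finset.sum_congr rfl fun v _ ↦ ?_
    have : β v * (r v * p v) ^ 2 = r v ^ 2 * (p v * (A *ᵥ p) v) := by rw [hp]; ring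
    rw [this, mulVec, dotProduct, Finset.mul_sum, Finset.mul_sum]
    exact Finset.sum_congr rfl fun w _ ↦ by ring
  have h2 : ∑ v, β v * (r v * p v) ^ 2 = ∑ v, ∑ w, A v w * (p v * p w) * r w ^ 2 := by
    rw [h1, Finset.sum_comm]
    refine Finset.sum_congr rfl fun v _ ↦ Finset.sum_congr rfl fun w _ ↦ ?_
    rw [hA.apply]
    ring
  have h3 : (r * p) ⬝ᵥ A *ᵥ (r * p) = ∑ v, ∑ w, A v w * (p v * p w) * (r v * r w) := by
    simp only [dotProduct, mulVec, Finset.mul_sum, Pi.mul_apply]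
    exact Finset.sum_congr rfl fun v _ ↦ Finset.sum_congr rfl fun w _ ↦ by ring
  have h4 : ∑ v, ∑ w, A v w * (p v * p w) * (r v - r w) ^ 2
      = (∑ v, ∑ w, A v w * (p v * p w) * r v ^ 2) + (∑ v, ∑ w, A v w * (p v * p w) * r w ^ 2)
        - 2 * ∑ v, ∑ w, A v w * (p v * p w) * (r v * r w) := by
    simp only [Finset.mul_sum, ← Finset.sum_add_distrib, ← Finset.sum_sub_distrib]
    exact Finset.sum_congr rfl fun v _ ↦ Finset.sum_congr rfl fun w _ ↦ by ring
  rw [h4, ← h1, ← h2, h3]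
  ring

/-! ### Vectors supported on the components of `G - u` -/

-- Extension by zero of the Perron vector of `C`. Vertices of other components have no neighbour in
-- `C`, so the eigenvector equation can fail only at `u`.
open Matrix in
theorem exists_component_vector {V : Type*} [Fintype V] (G : SimpleGraph V)
    [DecidableRel G.Adj] (u : V) (C : (deleteVertex G u).ConnectedComponent) :
    ∃ p : V → ℝ, p u = 0 ∧
      (∀ v : ({u}ᶜ : Set V), (deleteVertex G u).connectedComponentMk v = C → 0 < p v) ∧
      (∀ v : ({u}ᶜ : Set V), (deleteVertex G u).connectedComponentMk v ≠ C → p v = 0) ∧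
      ∀ v : ({u}ᶜ : Set V), (G.adjMatrix ℝ *ᵥ p) v = graphIndex C.toSimpleGraph * p v := by
  classical
  let : Fintype C.supp := Fintype.ofFinite C.supp
  obtain ⟨q, hq0, hq⟩ := SimpleGraph.Connected.exists_pos_eigenvector (V := C.supp)
    (G := C.toSimpleGraph) C.connected_toSimpleGraph
  let f : C.supp → V := fun a ↦ a.1.1
  have hf : Function.Injective f := fun a b h ↦ Subtype.ext (Subtype.ext h)
  have hmem (v : ({u}ᶜ : Set V)) :
      (deleteVertex G u).connectedComponentMk v ≠ C → ¬ ∃ a, f a = v := by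
    rintro hv ⟨a, ha⟩
    have : a.1 = v := Subtype.ext ha
    exact hv (this ▸ a.2)
  have hsum (v : V) : (G.adjMatrix ℝ *ᵥ Function.extend f q 0) v
      = ∑ a : C.supp, G.adjMatrix ℝ v (f a) * q a := by
    rw [mulVec, dotProduct, ← Finset.sum_subset (Finset.subset_univ (Finset.univ.image f)),
      Finset.sum_image hf.injOn]
    · simp [hf.extend_apply]
    · intro w _ hw
      rw [Function.extend_apply' _ _ _ (by simpa using hw)]
      simp
  refine ⟨Function.extend f q 0, ?_, fun v hv ↦ ?_, fun v hv ↦ ?_, fun v ↦ ?_⟩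
  · rw [Function.extend_apply']
    · rfl
    · rintro ⟨a, ha⟩
      exact a.1.2 ha
  · have : f ⟨v, hv⟩ = v := rfl
    rw [← this, hf.extend_apply]
    exact hq0 _
  · rw [Function.extend_apply' _ _ _ (hmem v hv)]
    rfl
  · rw [hsum]
    by_cases hv : (deleteVertex G u).connectedComponentMk v = C
    · have h1 : f ⟨v, hv⟩ = v := rfl
      have h2 := congrFun hq ⟨v, hv⟩
      rw [← h1, hf.extend_apply]
      rw [Pi.smul_apply, smul_eq_mul] at h2
      rw [← h2, mulVec, dotProduct]
      refine Finset.sum_congr rfl fun a _ ↦ ?_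
      simp only [SimpleGraph.adjMatrix_apply]
      congr 1
      exact if_congr Iff.rfl rfl rfl
    · rw [Function.extend_apply' _ _ _ (hmem v hv), Pi.zero_apply, mul_zero]
      refine Finset.sum_eq_zero fun a _ ↦ ?_
      rw [SimpleGraph.adjMatrix_apply, if_neg, zero_mul]
      intro h
      have h' : (deleteVertex G u).Adj v a.1 := h
      exact hv ((SimpleGraph.ConnectedComponent.connectedComponentMk_eq_of_adj h').trans a.2)

open Matrix in
/-- The Perron vectors of the components of `G - u` glued to a vector of `G`. -/
theorem exists_deleteVertex_vector {V : Type*} [Fintype V] (G : SimpleGraph V)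
    [DecidableRel G.Adj] (u : V) :
    ∃ p : V → ℝ, p u = 0 ∧ (∀ v : ({u}ᶜ : Set V), 0 < p v) ∧
      ∀ v : ({u}ᶜ : Set V), (G.adjMatrix ℝ *ᵥ p) v =
        graphIndex ((deleteVertex G u).connectedComponentMk v).toSimpleGraph * p v := by
  classical
  choose P hPu hPpos _ hP using exists_component_vector G u
  refine ⟨fun v ↦ if hv : v ∈ ({u}ᶜ : Set V) then
    P ((deleteVertex G u).connectedComponentMk ⟨v, hv⟩) v else 0, by simp, fun v ↦ ?_, fun v ↦ ?_⟩
  · beta_reduce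
    rw [dif_pos v.2]
    exact hPpos _ v rfl
  · beta_reduce
    rw [dif_pos v.2]
    refine Eq.trans ?_ (hP _ v)
    simp only [mulVec, dotProduct, SimpleGraph.adjMatrix_apply]
    refine Finset.sum_congr rfl fun w _ ↦ ?_
    split_ifs with h hw
    · have h' : (deleteVertex G u).Adj v ⟨w, hw⟩ := h
      rw [SimpleGraph.ConnectedComponent.connectedComponentMk_eq_of_adj h']
    · have : w = u := by simpa using hw
      rw [this, hPu]
    · simp
    · simp

open Matrix in
/-- The defect of the Rayleigh quotient on vectors vanishing at `u`, relative to the indices of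
the components of `G - u`. -/
theorem exists_deleteVertex_defect {V : Type*} [Fintype V] (G : SimpleGraph V)
    [DecidableRel G.Adj] (u : V) (α : ℝ)
    (hα : ∀ C : (deleteVertex G u).ConnectedComponent, graphIndex C.toSimpleGraph ≤ α) :
    ∃ p : V → ℝ, p u = 0 ∧ (∀ v : ({u}ᶜ : Set V), 0 < p v) ∧
      ∀ z : V → ℝ, z u = 0 → z ⬝ᵥ G.adjMatrix ℝ *ᵥ z ≤ α * (z ⬝ᵥ z) ∧
        (z ⬝ᵥ G.adjMatrix ℝ *ᵥ z = α * (z ⬝ᵥ z) →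
          (∀ v : ({u}ᶜ : Set V), graphIndex
            ((deleteVertex G u).connectedComponentMk v).toSimpleGraph < α → z v = 0) ∧
          ∀ v w : ({u}ᶜ : Set V), (deleteVertex G u).Adj v w → z v / p v = z w / p w) := by
  classical
  obtain ⟨p, hpu, hpos, hp⟩ := exists_deleteVertex_vector G u
  refine ⟨p, hpu, hpos, fun z hz ↦ ?_⟩
  -- The value at `u` is immaterial because `p u = 0`; choosing `α` keeps `β ≤ α` everywhere.
  let β : V → ℝ := fun v ↦ if hv : v ∈ ({u}ᶜ : Set V) then
    graphIndex ((deleteVertex G u).connectedComponentMk ⟨v, hv⟩).toSimpleGraph else α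
  have hβ (v : V) : β v ≤ α := by
    simp only [β]
    split_ifs
    · exact hα _
    · exact le_rfl
  have hp0 (v : V) : 0 ≤ p v := by
    by_cases hv : v = u
    · rw [hv, hpu]
    · exact (hpos ⟨v, hv⟩).le
  have hrp (v : V) : z v / p v * p v = z v := by
    by_cases hv : v = u
    · rw [hv, hpu, hz, mul_zero]
    · exact div_mul_cancel₀ _ (hpos ⟨v, hv⟩).ne'
  have hrp' : ((fun v ↦ z v / p v) * p : V → ℝ) = z := funext hrp
  have key := sum_sub_dotProduct_mulVec_eq (G.isSymm_adjMatrix (α := ℝ)) p (fun v ↦ z v / p v) β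
    (fun v ↦ by
      by_cases hv : v = u
      · simp [hv, hpu]
      · have hv' : v ∈ ({u}ᶜ : Set V) := hv
        simp only [β, dif_pos hv']
        rw [hp ⟨v, hv'⟩]
        ring)
  rw [hrp'] at key
  simp only [hrp] at key
  have hterm (v w : V) : 0 ≤ G.adjMatrix ℝ v w * (p v * p w) * (z v / p v - z w / p w) ^ 2 := by
    have h1 := hp0 v
    have h2 := hp0 w
    rw [SimpleGraph.adjMatrix_apply]
    split_ifs <;> positivity
  have hrow (v : V) :
      0 ≤ ∑ w, G.adjMatrix ℝ v w * (p v * p w) * (z v / p v - z w / p w) ^ 2 :=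
    Finset.sum_nonneg fun w _ ↦ hterm v w
  have hD : 0 ≤ ∑ v, ∑ w, G.adjMatrix ℝ v w * (p v * p w) * (z v / p v - z w / p w) ^ 2 :=
    Finset.sum_nonneg fun v _ ↦ hrow v
  have hE : α * (z ⬝ᵥ z) - ∑ v, β v * z v ^ 2 = ∑ v, (α - β v) * z v ^ 2 := by
    rw [dotProduct, Finset.mul_sum, ← Finset.sum_sub_distrib]
    exact Finset.sum_congr rfl fun v _ ↦ by ring
  have hEterm (v : V) : 0 ≤ (α - β v) * z v ^ 2 :=
    mul_nonneg (sub_nonneg.2 (hβ v)) (sq_nonneg _)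
  have hE0 : 0 ≤ ∑ v, (α - β v) * z v ^ 2 := Finset.sum_nonneg fun v _ ↦ hEterm v
  -- The slack is the sum of the nonnegative term in `α - β` and half the edge sum; equality makes
  -- every summand of both vanish.
  refine ⟨by linarith, fun heq ↦ ?_⟩
  have hE' : ∑ v, (α - β v) * z v ^ 2 = 0 := by linarith
  have hD' : ∑ v, ∑ w, G.adjMatrix ℝ v w * (p v * p w) * (z v / p v - z w / p w) ^ 2 = 0 := by
    linarith
  rw [Finset.sum_eq_zero_iff_of_nonneg fun v _ ↦ hEterm v] at hE'
  rw [Finset.sum_eq_zero_iff_of_nonneg fun v _ ↦ hrow v] at hD'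
  refine ⟨fun v hv ↦ ?_, fun v w hvw ↦ ?_⟩
  · have h := hE' v (Finset.mem_univ _)
    simp only [β, dif_pos v.2] at h
    rcases mul_eq_zero.1 h with h | h
    · exact absurd h (sub_pos.2 hv).ne'
    · exact pow_eq_zero_iff two_ne_zero |>.1 h
  · have h := hD' v (Finset.mem_univ _)
    rw [Finset.sum_eq_zero_iff_of_nonneg fun w _ ↦ hterm v w] at h
    have h := h w (Finset.mem_univ _)
    have hvw' : G.Adj v w := hvw
    rw [SimpleGraph.adjMatrix_apply, if_pos hvw', one_mul] at h
    rcases mul_eq_zero.1 h with h | h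
    · exact absurd h (mul_pos (hpos v) (hpos w)).ne'
    · exact sub_eq_zero.1 (pow_eq_zero_iff two_ne_zero |>.1 h)

/-- A walk from the component to `u` must leave the component, and an edge leaving it can only end
at `u`. -/
theorem SimpleGraph.Connected.exists_adj_component {V : Type*} {G : SimpleGraph V}
    (hG : G.Connected) (u : V) (C : (deleteVertex G u).ConnectedComponent) :
    ∃ w : ({u}ᶜ : Set V), (deleteVertex G u).connectedComponentMk w = C ∧ G.Adj u w := by
  obtain ⟨v, rfl⟩ := C.exists_rep
  obtain ⟨q⟩ := hG.preconnected v u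
  obtain ⟨d, -, ⟨hd, hd'⟩, hd2⟩ := q.exists_boundary_dart
    {w | ∃ hw : w ∈ ({u}ᶜ : Set V), (deleteVertex G u).connectedComponentMk ⟨w, hw⟩ =
      (deleteVertex G u).connectedComponentMk v} ⟨v.2, rfl⟩ (fun h ↦ h.1 rfl)
  have hs : d.snd = u := by
    by_contra hne
    have h : (deleteVertex G u).Adj ⟨d.snd, hne⟩ ⟨d.fst, hd⟩ := d.adj.symm
    exact hd2 ⟨hne, (SimpleGraph.ConnectedComponent.connectedComponentMk_eq_of_adj h).trans hd'⟩
  exact ⟨⟨d.fst, hd⟩, hd', hs ▸ d.adj.symm⟩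

open Matrix in
/-- No vector vanishing at `u` whose Rayleigh quotient is the simple largest component index
of `G - u` satisfies the eigenvector equation at `u`. -/
theorem SimpleGraph.Connected.mulVec_apply_ne_zero {V : Type*} [Fintype V] {G : SimpleGraph V}
    [DecidableRel G.Adj] (hG : G.Connected) (u : V)
    (C₁ : (deleteVertex G u).ConnectedComponent)
    (hC : ∀ C, C ≠ C₁ → graphIndex C.toSimpleGraph < graphIndex C₁.toSimpleGraph)
    {z : V → ℝ} (hz0 : z ≠ 0) (hzu : z u = 0)
    (hz : z ⬝ᵥ G.adjMatrix ℝ *ᵥ z = graphIndex C₁.toSimpleGraph * (z ⬝ᵥ z)) :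
    (G.adjMatrix ℝ *ᵥ z) u ≠ 0 := by
  obtain ⟨p, hpu, hpos, hp⟩ := exists_deleteVertex_defect G u (graphIndex C₁.toSimpleGraph)
    (fun C ↦ by
      by_cases h : C = C₁
      · rw [h]
      · exact (hC C h).le)
  obtain ⟨hoff, hadj⟩ := (hp z hzu).2 hz
  obtain ⟨w₀, hw₀, hw₀u⟩ := hG.exists_adj_component u C₁
  have hconst (v : ({u}ᶜ : Set V)) (hv : (deleteVertex G u).connectedComponentMk v = C₁) :
      z v = z w₀ / p w₀ * p v := by
    obtain ⟨q⟩ := SimpleGraph.ConnectedComponent.exact (hv.trans hw₀.symm)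
    have h : z v / p v = z w₀ / p w₀ := by
      clear hv hw₀ hw₀u
      induction q with
      | nil => rfl
      | cons h _ ih => exact (hadj _ _ h).trans ih
    rw [← h, div_mul_cancel₀ _ (hpos v).ne']
  have hoff' (v : ({u}ᶜ : Set V)) (hv : (deleteVertex G u).connectedComponentMk v ≠ C₁) :
      z v = 0 := hoff v (hC _ hv)
  set c := z w₀ / p w₀ with hc
  have hc0 : c ≠ 0 := by
    intro h
    refine hz0 (funext fun v ↦ ?_)
    by_cases hv : v = u
    · simpa [hv] using hzu
    by_cases hvC : (deleteVertex G u).connectedComponentMk ⟨v, hv⟩ = C₁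
    · simpa [h] using hconst ⟨v, hv⟩ hvC
    · simpa using hoff' ⟨v, hv⟩ hvC
  -- Dividing by `c` removes the unknown sign: `z / c` agrees with `p` on `C₁` and is zero
  -- elsewhere.
  have hnonneg (v : V) : 0 ≤ z v / c := by
    by_cases hv : v = u
    · simp [hv, hzu]
    by_cases hvC : (deleteVertex G u).connectedComponentMk ⟨v, hv⟩ = C₁
    · rw [hconst ⟨v, hv⟩ hvC, mul_div_cancel_left₀ _ hc0]
      exact (hpos ⟨v, hv⟩).le
    · rw [hoff' ⟨v, hv⟩ hvC, zero_div]
  have hsum : 0 < ∑ v ∈ G.neighborFinset u, z v / c := by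
    refine Finset.sum_pos' (fun v _ ↦ hnonneg v) ⟨w₀, by simpa using hw₀u, ?_⟩
    rw [hconst w₀ hw₀, mul_div_cancel_left₀ _ hc0]
    exact hpos w₀
  rw [← Finset.sum_div] at hsum
  rw [SimpleGraph.adjMatrix_mulVec_apply]
  intro h
  simp [h] at hsum

/-! ### The bounds on the second eigenvalue -/

/-- Selects a nonzero vector of a plane satisfying one linear condition: orthogonality to `x` for
the lower bound, vanishing at `u` for the upper bound. -/
theorem exists_mul_add_mul_eq_zero (s t : ℝ) : ∃ a b : ℝ, (a ≠ 0 ∨ b ≠ 0) ∧ a * s + b * t = 0 := by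
  by_cases hs : s = 0
  · exact ⟨1, 0, by simp, by simp [hs]⟩
  · exact ⟨-t, s, Or.inr hs, by ring⟩

open Matrix in
theorem SimpleGraph.Connected.le_secondEigenvalue {V : Type*} [Fintype V] [Nontrivial V]
    {G : SimpleGraph V} (hG : G.Connected) (u : V)
    (C₁ C₂ : (deleteVertex G u).ConnectedComponent) (hne : C₁ ≠ C₂)
    (hle : graphIndex C₂.toSimpleGraph ≤ graphIndex C₁.toSimpleGraph) :
    graphIndex C₂.toSimpleGraph ≤ secondEigenvalue G ∧
      (graphIndex C₂.toSimpleGraph < graphIndex C₁.toSimpleGraph →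
        graphIndex C₂.toSimpleGraph < secondEigenvalue G) := by
  classical
  have hA := G.isSymm_adjMatrix (α := ℝ)
  obtain ⟨μ, x, y, hμ, hxx, hyy, hxy, hx, hy, hmax⟩ := secondEigenvalue_spec G
  obtain ⟨p, hpu, hp1, hp2, hp⟩ := exists_component_vector G u C₁
  obtain ⟨q, hqu, hq1, hq2, hq⟩ := exists_component_vector G u C₂
  set α₁ := graphIndex C₁.toSimpleGraph
  set α₂ := graphIndex C₂.toSimpleGraph
  have hpq (v : V) : p v * q v = 0 := by
    by_cases hv : v = u
    · rw [hv, hpu, zero_mul]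
    by_cases hvC : (deleteVertex G u).connectedComponentMk ⟨v, hv⟩ = C₁
    · rw [hq2 ⟨v, hv⟩ (hvC ▸ hne), mul_zero]
    · rw [hp2 ⟨v, hv⟩ hvC, zero_mul]
  have hfp (f : V → ℝ) (hf : f u = 0) : f ⬝ᵥ G.adjMatrix ℝ *ᵥ p = α₁ * (f ⬝ᵥ p) := by
    rw [dotProduct, dotProduct, Finset.mul_sum]
    refine Finset.sum_congr rfl fun v _ ↦ ?_
    by_cases hv : v = u
    · rw [hv, hf]; ring
    · rw [hp ⟨v, hv⟩]; ring
  have hfq (f : V → ℝ) (hf : f u = 0) : f ⬝ᵥ G.adjMatrix ℝ *ᵥ q = α₂ * (f ⬝ᵥ q) := by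
    rw [dotProduct, dotProduct, Finset.mul_sum]
    refine Finset.sum_congr rfl fun v _ ↦ ?_
    by_cases hv : v = u
    · rw [hv, hf]; ring
    · rw [hq ⟨v, hv⟩]; ring
  have hpq0 : p ⬝ᵥ q = 0 := Finset.sum_eq_zero fun v _ ↦ hpq v
  have hqp0 : q ⬝ᵥ p = 0 := by rw [dotProduct_comm, hpq0]
  have hpos (f : V → ℝ) (hf : f ≠ 0) : 0 < f ⬝ᵥ f := by
    have h1 : 0 ≤ f ⬝ᵥ f := Finset.sum_nonneg fun v _ ↦ mul_self_nonneg _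
    exact h1.lt_of_ne' fun h ↦ hf (dotProduct_self_eq_zero.1 h)
  obtain ⟨w₁, hw₁, -⟩ := hG.exists_adj_component u C₁
  obtain ⟨w₂, hw₂, hw₂u⟩ := hG.exists_adj_component u C₂
  have hpp : 0 < p ⬝ᵥ p := hpos p fun h ↦ (hp1 w₁ hw₁).ne' (by rw [h]; rfl)
  have hqq : 0 < q ⬝ᵥ q := hpos q fun h ↦ (hq1 w₂ hw₂).ne' (by rw [h]; rfl)
  obtain ⟨a, b, hab, hab0⟩ := exists_mul_add_mul_eq_zero (p ⬝ᵥ x) (q ⬝ᵥ x)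
  set w : V → ℝ := a • p + b • q with hw
  have hwx : w ⬝ᵥ x = 0 := by
    simp only [hw, add_dotProduct, smul_dotProduct, smul_eq_mul, hab0]
  have hww : w ⬝ᵥ w = a ^ 2 * (p ⬝ᵥ p) + b ^ 2 * (q ⬝ᵥ q) := by
    simp only [hw, add_dotProduct, dotProduct_add, smul_dotProduct, dotProduct_smul, smul_eq_mul,
      hpq0, hqp0]
    ring
  have hwAw : w ⬝ᵥ G.adjMatrix ℝ *ᵥ w = α₁ * (a ^ 2 * (p ⬝ᵥ p)) + α₂ * (b ^ 2 * (q ⬝ᵥ q)) := by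
    simp only [hw, mulVec_add, mulVec_smul, add_dotProduct, dotProduct_add, smul_dotProduct,
      dotProduct_smul, smul_eq_mul, hfp p hpu, hfp q hqu, hfq p hpu, hfq q hqu, hpq0, hqp0]
    ring
  have hww0 : 0 < w ⬝ᵥ w := by
    rw [hww]
    rcases hab with h | h <;> positivity
  have hP : 0 ≤ a ^ 2 * (p ⬝ᵥ p) := by positivity
  have hbound := hmax w hwx
  have hlow : α₂ * (w ⬝ᵥ w) ≤ w ⬝ᵥ G.adjMatrix ℝ *ᵥ w := by
    rw [hwAw, hww]
    nlinarith
  have hmain : α₂ ≤ secondEigenvalue G := le_of_mul_le_mul_right (hlow.trans hbound) hww0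
  refine ⟨hmain, fun hlt ↦ hmain.lt_of_ne fun heq ↦ ?_⟩
  rw [← heq] at hbound hy hmax hμ
  -- Any share of `p` would push the quotient of `w` strictly above `α₂`; hence `q` itself is
  -- orthogonal to `x`.
  have ha : a = 0 := by
    by_contra ha
    have : 0 < a ^ 2 * (p ⬝ᵥ p) := by positivity
    rw [hwAw, hww] at hbound
    nlinarith
  have hb : b ≠ 0 := by simpa [ha] using hab
  have hqx : q ⬝ᵥ x = 0 := by simpa [ha, hb] using hab0
  let S : Submodule ℝ (V → ℝ) :=
    { carrier := {z | z ⬝ᵥ x = 0}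
      zero_mem' := by simp
      add_mem' := fun {f g} hf hg ↦ by
        simp only [Set.mem_ofPred_eq, add_dotProduct] at hf hg ⊢
        rw [hf, hg, add_zero]
      smul_mem' := fun c f hf ↦ by
        simp only [Set.mem_ofPred_eq, smul_dotProduct] at hf ⊢
        rw [hf, smul_zero] }
  -- Stationarity on the complement of `x` extends to every `v`, since `q` and its image are both
  -- orthogonal to `x`. Thus `q` is an eigenvector.
  have hstat (v : V → ℝ) : v ⬝ᵥ G.adjMatrix ℝ *ᵥ q = α₂ * (v ⬝ᵥ q) := by
    have hxq : x ⬝ᵥ q = 0 := by rw [dotProduct_comm, hqx]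
    have h := dotProduct_mulVec_eq_of_rayleigh_eq hA S hmax (z := q) hqx (hfq q hqu)
      (v := v - (v ⬝ᵥ x) • x) (by
        change (v - (v ⬝ᵥ x) • x) ⬝ᵥ x = 0
        rw [sub_dotProduct, smul_dotProduct, hxx, smul_eq_mul, mul_one, sub_self])
    have hxAq : x ⬝ᵥ G.adjMatrix ℝ *ᵥ q = 0 := by
      rw [dotProduct_mulVec_of_isSymm hA, hx, dotProduct_smul, hqx, smul_zero]
    simpa only [sub_dotProduct, smul_dotProduct, hxAq, hxq, smul_zero, sub_zero] using h
  have hu := hstat (Pi.single u 1)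
  rw [single_one_dotProduct, single_one_dotProduct, hqu, mul_zero,
    SimpleGraph.adjMatrix_mulVec_apply] at hu
  have hq0 (v : V) : 0 ≤ q v := by
    by_cases hv : v = u
    · rw [hv, hqu]
    by_cases hvC : (deleteVertex G u).connectedComponentMk ⟨v, hv⟩ = C₂
    · exact (hq1 ⟨v, hv⟩ hvC).le
    · exact (hq2 ⟨v, hv⟩ hvC).ge
  rw [Finset.sum_eq_zero_iff_of_nonneg fun v _ ↦ hq0 v] at hu
  exact (hq1 w₂ hw₂).ne' (hu w₂ (by simpa using hw₂u))

open Matrix in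
theorem SimpleGraph.Connected.secondEigenvalue_le {V : Type*} [Fintype V] [Nontrivial V]
    {G : SimpleGraph V} (hG : G.Connected) (u : V)
    (C₁ : (deleteVertex G u).ConnectedComponent)
    (hC : ∀ C : (deleteVertex G u).ConnectedComponent,
      graphIndex C.toSimpleGraph ≤ graphIndex C₁.toSimpleGraph) :
    secondEigenvalue G ≤ graphIndex C₁.toSimpleGraph ∧
      ((∀ C, C ≠ C₁ → graphIndex C.toSimpleGraph < graphIndex C₁.toSimpleGraph) →
        secondEigenvalue G < graphIndex C₁.toSimpleGraph) := by
  classical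
  obtain ⟨μ, x, y, hμ, hxx, hyy, hxy, hx, hy, -⟩ := secondEigenvalue_spec G
  obtain ⟨p, -, -, hp⟩ := exists_deleteVertex_defect G u _ hC
  have hyx : y ⬝ᵥ x = 0 := by rw [dotProduct_comm, hxy]
  obtain ⟨a, b, hab, hab0⟩ := exists_mul_add_mul_eq_zero (x u) (y u)
  set w : V → ℝ := a • x + b • y with hw
  have hwu : w u = 0 := by simpa [hw] using hab0
  have hww : w ⬝ᵥ w = a ^ 2 + b ^ 2 := by
    simp only [hw, add_dotProduct, dotProduct_add, smul_dotProduct, dotProduct_smul, smul_eq_mul,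
      hxx, hyy, hxy, hyx]
    ring
  have hAw : G.adjMatrix ℝ *ᵥ w = (μ * a) • x + (secondEigenvalue G * b) • y := by
    rw [hw, mulVec_add, mulVec_smul, mulVec_smul, hx, hy, smul_smul, smul_smul, mul_comm a,
      mul_comm b]
  have hwAw : w ⬝ᵥ G.adjMatrix ℝ *ᵥ w = μ * a ^ 2 + secondEigenvalue G * b ^ 2 := by
    rw [hAw]
    simp only [hw, add_dotProduct, dotProduct_add, smul_dotProduct, dotProduct_smul, smul_eq_mul,
      hxx, hyy, hxy, hyx]
    ring
  have hww0 : 0 < w ⬝ᵥ w := by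
    rw [hww]
    rcases hab with h | h <;> positivity
  have hlow : secondEigenvalue G * (w ⬝ᵥ w) ≤ w ⬝ᵥ G.adjMatrix ℝ *ᵥ w := by
    rw [hwAw, hww]
    nlinarith [sq_nonneg a]
  have hup := (hp w hwu).1
  have hmain := le_of_mul_le_mul_right (hlow.trans hup) hww0
  refine ⟨hmain, fun hlt ↦ hmain.lt_of_ne fun heq ↦ ?_⟩
  rw [← heq] at hup
  have hrayleigh := hup.antisymm hlow
  -- Either `μ` equals `λ₂` or `w` is a multiple of `y`; in both cases `w` is an eigenvector for
  -- `λ₂`.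
  have hμa : μ * a = secondEigenvalue G * a := by
    rw [hwAw, hww] at hrayleigh
    have h : (μ - secondEigenvalue G) * a ^ 2 = 0 := by linarith
    rcases mul_eq_zero.1 h with h | h
    · rw [sub_eq_zero.1 h]
    · rw [pow_eq_zero_iff two_ne_zero |>.1 h, mul_zero, mul_zero]
  refine hG.mulVec_apply_ne_zero u C₁ hlt (z := w) (fun h ↦ ?_) hwu (heq ▸ hrayleigh) ?_
  · simp [h] at hww0
  · rw [hAw, hμa, mul_smul, mul_smul, ← smul_add, ← hw, Pi.smul_apply, hwu, smul_zero]

theorem corollary1 {V : Type*} [Finite V] (G : SimpleGraph V) (hG : G.Connected)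
    (u : V) (hu : IsCutVertex G u) (α₁ α₂ : ℝ)
    (hα : AreTwoLargestComponentIndices (deleteVertex G u) α₁ α₂) :
    (α₁ = α₂ → secondEigenvalue G = α₁) ∧
      (α₂ < α₁ → α₂ < secondEigenvalue G ∧ secondEigenvalue G < α₁) := by
  let := Fintype.ofFinite V
  obtain ⟨C₁, C₂, hne, rfl, rfl, hle, hmax⟩ := hα
  obtain ⟨v, -, -, -⟩ := hu
  have : Nontrivial V := ⟨v, u, v.2⟩
  have hlow := hG.le_secondEigenvalue u C₁ C₂ hne hle
  have hup := hG.secondEigenvalue_le u C₁ fun C ↦ by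
    by_cases h : C = C₁
    · rw [h]
    · exact (hmax C h).trans hle
  exact ⟨fun h ↦ hup.1.antisymm (h ▸ hlow.1), fun h ↦
    ⟨hlow.2 h, hup.2 fun C hC ↦ (hmax C hC).trans_lt h⟩⟩
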